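/- Let $k$ be a field, let $a,d\ge 1$ and $b\in\{1,2,3\}$ be integers, and put $m_0=3a+b$ and $m_i=m_0+id$ for $1\le i\le 3$. Assume $\gcd(m_0,m_1,m_2,m_3)=1$. Let $C\subset\mathbb A^4$ be the monomial curve parametrized by $x_0=t^{m_0}$, $x_1=t^{m_1}$, $x_2=t^{m_2}$, $y=t^{m_3}$, and let $I(C)\subset k[x_0,x_1,x_2,y]$ be its defining ideal, i.e. the kernel of the $k$-algebra homomorphism $k[x_0,x_1,x_2,y]\to k[t]$ with $x_i\mapsto t^{m_i}$ $(0\le i\le 2)$ and $y\mapsto t^{m_3}$. For a nonzero polynomial $f$ let $f^*$ be its homogeneous summand of least degree, put $0^*=0$, and let $I(C)^*$ be the ideal generated by all $f^*$ with $f\in I(C)$ (the defining ideal of the tangent cone of $C$ at the origin). Put $$\xi_{11}=x_1^2-x_0x_2,\qquad \varphi_i=x_{i+1}x_2-x_iy\ (i=0,1),\qquad \theta=y^{a+1}-x_0^{a+d}x_{3-b},$$ $$\psi_j=x_{b+j}y^a-x_0^{a+d}x_j\quad (1\le b\le 2,\ 0\le j\le 2-b),$$ and let $G=\{\xi_{11},\varphi_0,\varphi_1,\psi_0,\psi_1,\theta\}$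 if $b=1$, $G=\{\xi_{11},\varphi_0,\varphi_1,\psi_0,\theta\}$ if $b=2$, and $G=\{\xi_{11},\varphi_0,\varphi_1,\theta\}$ if $b=3$. Then $G$ generates $I(C)$, and $I(C)^*$ is generated by $G^*=\{g^* : g\in G\}$. Explicitly, - if $b=1$: $G^*=\{x_1^2-x_0x_2,\ x_1x_2-x_0y,\ x_2^2-x_1y,\ x_1y^a,\ x_2y^a,\ y^{a+1}\}$; - if $b=2$: $G^*=\{x_1^2-x_0x_2,\ x_1x_2-x_0y,\ x_2^2-x_1y,\ x_2y^a,\ y^{a+1}\}$; - if $b=3$: $G^*=\{x_1^2-x_0x_2,\ x_1x_2-x_0y,\ x_2^2-x_1y,\ y^{a+1}\}$. -/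

import Mathlib

open MvPolynomial

namespace CertainMonomialCurve

noncomputable section

/-- The `k`-algebra homomorphism `φ : k[x₀, x₁, x₂, y] → k[t]`, `xᵢ ↦ t ^ mᵢ`
(with `y = x₃`); its range is `k[t ^ m₀, t ^ m₁, t ^ m₂, t ^ m₃]`. -/
def paramHom (k : Type*) [Field k] (m : Fin 4 → ℕ) :
    MvPolynomial (Fin 4) k →ₐ[k] Polynomial k :=
  aeval (fun i => (Polynomial.X : Polynomial k) ^ m i)

/-- The defining ideal `I(C) = ker φ` of the monomial curve `C`
parametrized by `xᵢ = t ^ mᵢ`. -/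
def definingIdeal (k : Type*) [Field k] (m : Fin 4 → ℕ) :
    Ideal (MvPolynomial (Fin 4) k) :=
  RingHom.ker (paramHom k m)

/-- `f ^ *`: the homogeneous summand of `f` of least degree, i.e. the homogeneous component
of `f` in the smallest degree where that component is nonzero (and `0 ^ * = 0`). -/
def leastForm {k : Type*} [Field k] (f : MvPolynomial (Fin 4) k) :
    MvPolynomial (Fin 4) k :=
  homogeneousComponent (sInf {n : ℕ | homogeneousComponent n f ≠ 0}) f

/-- `I ^ *`: the ideal generated by the forms `f ^ *` for `f ∈ I`. For `I = I(C)` this is the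
defining ideal of the tangent cone of `C` at the origin. -/
def tangentConeIdeal {k : Type*} [Field k] (I : Ideal (MvPolynomial (Fin 4) k)) :
    Ideal (MvPolynomial (Fin 4) k) :=
  Ideal.span (leastForm '' (I : Set (MvPolynomial (Fin 4) k)))

/-- The variable `xᵢ` for `0 ≤ i ≤ 3`, where `x₃ = y`. -/
def x (k : Type*) [Field k] (i : ℕ) : MvPolynomial (Fin 4) k := X (Fin.ofNat 4 i)

/-- The variable `y = x₃`. -/
def y (k : Type*) [Field k] : MvPolynomial (Fin 4) k := X 3

/-- `ξ₁₁ = x₁² - x₀ x₂`. -/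
def xi (k : Type*) [Field k] : MvPolynomial (Fin 4) k :=
  x k 1 ^ 2 - x k 0 * x k 2

/-- `φᵢ = xᵢ₊₁ x₂ - xᵢ y`, used for `0 ≤ i ≤ 1`. -/
def phi (k : Type*) [Field k] (i : ℕ) : MvPolynomial (Fin 4) k :=
  x k (i + 1) * x k 2 - x k i * y k

/-- `ψⱼ = x_{b+j} y ^ a - x₀ ^ (a+d) xⱼ`, used for `1 ≤ b ≤ 2` and `0 ≤ j ≤ 2 - b`. -/
def psi (k : Type*) [Field k] (a b d j : ℕ) : MvPolynomial (Fin 4) k :=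
  x k (b + j) * y k ^ a - x k 0 ^ (a + d) * x k j

/-- `θ = y ^ (a+1) - x₀ ^ (a+d) x_{3-b}`, used for `1 ≤ b ≤ 3`. -/
def theta (k : Type*) [Field k] (a b d : ℕ) : MvPolynomial (Fin 4) k :=
  y k ^ (a + 1) - x k 0 ^ (a + d) * x k (3 - b)

/-- Patil's set `G` of binomials, for `b ∈ {1, 2, 3}`. -/
def G (k : Type*) [Field k] (a b d : ℕ) : Set (MvPolynomial (Fin 4) k) :=
  if b = 1 then {xi k, phi k 0, phi k 1, psi k a b d 0, psi k a b d 1, theta k a b d}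
  else if b = 2 then {xi k, phi k 0, phi k 1, psi k a b d 0, theta k a b d}
  else {xi k, phi k 0, phi k 1, theta k a b d}

end

end CertainMonomialCurve

namespace CertainMonomialCurve

/-! ### Normal forms of monomials on the twisted cubic -/

section CubicNormal

variable {R : Type*} [CommRing R]

/-! Modulo the twisted cubic relations, a monomial depends only on its degree `n` and its index sum
`r`, and its image on the curve is `t ^ (n * m₀ + r * d)`. The relations `ψⱼ`, with `θ` as the last
one, trade `r` for `r - m₀` and `n` for `n + d`, so every monomial reduces to one with `r < m₀`. As
`m₀` and `d` are coprime, that normal monomial is determined by the exponent of `t`. Hence, modulo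
`G`, every `f` equals a linear function of its image in `k[t]`, which vanishes for `f ∈ I(C)`
(`sub_powLift_mem`).

For the tangent cone, the trade strictly raises the degree. In the lowest degree of `f`, monomials
with `r ≥ m₀` are killed by `G ^ *`, and normal monomials of that degree come from no higher term.
The same linear argument, restricted to one degree, then applies
(`homogeneousComponent_sub_powLift_mem`). -/

/-- The monomial of degree `n` and index sum `r ≤ 3 n` in `v 0, …, v 3` that is a power of `v 0`
times at most one of `v 1`, `v 2`, times a power of `v 3`. -/
def cubicNormal (v : Fin 4 → R) (n r : ℕ) : R :=
  v 0 ^ (n - (r + 2) / 3) * (if r % 3 = 0 then 1 else if r % 3 = 1 then v 1 else v 2) *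
    v 3 ^ (r / 3)

/-- The three quadratic equations of the twisted cubic. -/
structure IsTwistedCubic (v : Fin 4 → R) : Prop where
  one_one : v 1 * v 1 = v 0 * v 2
  one_two : v 1 * v 2 = v 0 * v 3
  two_two : v 2 * v 2 = v 1 * v 3

theorem map_cubicNormal {S : Type*} [CommRing S] (f : R →+* S) (v : Fin 4 → R) (n r : ℕ) :
    f (cubicNormal v n r) = cubicNormal (fun i => f (v i)) n r := by
  unfold cubicNormal
  split_ifs <;> simp

theorem cubicNormal_zero_mul (v : Fin 4 → R) {n r : ℕ} (h : r ≤ 3 * n) :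
    v 0 * cubicNormal v n r = cubicNormal v (n + 1) r := by
  unfold cubicNormal
  rw [show n + 1 - (r + 2) / 3 = n - (r + 2) / 3 + 1 by omega, pow_succ]
  ring

theorem cubicNormal_three_mul (v : Fin 4 → R) (n r : ℕ) :
    v 3 * cubicNormal v n r = cubicNormal v (n + 1) (r + 3) := by
  unfold cubicNormal
  rw [show n + 1 - (r + 3 + 2) / 3 = n - (r + 2) / 3 by omega,
    show (r + 3) / 3 = r / 3 + 1 by omega, show (r + 3) % 3 = r % 3 by omega, pow_succ]
  ring

theorem exists_eq_three_mul_add (r : ℕ) :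
    ∃ c, r = 3 * c ∨ r = 3 * c + 1 ∨ r = 3 * c + 2 := ⟨r / 3, by omega⟩

theorem cubicNormal_three_mul_index (v : Fin 4 → R) (n c : ℕ) :
    cubicNormal v n (3 * c) = v 0 ^ (n - c) * v 3 ^ c := by
  unfold cubicNormal
  rw [show (3 * c + 2) / 3 = c by omega, show 3 * c / 3 = c by omega,
    if_pos (by omega), mul_one]

theorem cubicNormal_three_mul_index_add_one (v : Fin 4 → R) (n c : ℕ) :
    cubicNormal v n (3 * c + 1) = v 0 ^ (n - (c + 1)) * v 1 * v 3 ^ c := by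
  unfold cubicNormal
  rw [show (3 * c + 1 + 2) / 3 = c + 1 by omega, show (3 * c + 1) / 3 = c by omega,
    if_neg (by omega), if_pos (by omega)]

theorem cubicNormal_three_mul_index_add_two (v : Fin 4 → R) (n c : ℕ) :
    cubicNormal v n (3 * c + 2) = v 0 ^ (n - (c + 1)) * v 2 * v 3 ^ c := by
  unfold cubicNormal
  rw [show (3 * c + 2 + 2) / 3 = c + 1 by omega, show (3 * c + 2) / 3 = c by omega,
    if_neg (by omega), if_neg (by omega)]

/-- The bound `r ≤ 3 * n` keeps the truncated exponent of `v 0` honest; each carry past residue 2 is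
one cubic relation. -/
theorem IsTwistedCubic.one_mul_cubicNormal {v : Fin 4 → R} (hv : IsTwistedCubic v) {n r : ℕ}
    (h : r ≤ 3 * n) : v 1 * cubicNormal v n r = cubicNormal v (n + 1) (r + 1) := by
  obtain ⟨c, rfl | rfl | rfl⟩ := exists_eq_three_mul_add r
  · rw [cubicNormal_three_mul_index, cubicNormal_three_mul_index_add_one,
      show n + 1 - (c + 1) = n - c by omega]
    ring
  · rw [cubicNormal_three_mul_index_add_one, show 3 * c + 1 + 1 = 3 * c + 2 by omega,
      cubicNormal_three_mul_index_add_two,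
      show n + 1 - (c + 1) = n - (c + 1) + 1 by omega, pow_succ]
    linear_combination (v 0 ^ (n - (c + 1)) * v 3 ^ c) * hv.one_one
  · rw [cubicNormal_three_mul_index_add_two, show 3 * c + 2 + 1 = 3 * (c + 1) by omega,
      cubicNormal_three_mul_index,
      show n + 1 - (c + 1) = n - (c + 1) + 1 by omega, pow_succ, pow_succ]
    linear_combination (v 0 ^ (n - (c + 1)) * v 3 ^ c) * hv.one_two

theorem IsTwistedCubic.two_mul_cubicNormal {v : Fin 4 → R} (hv : IsTwistedCubic v) {n r : ℕ}
    (h : r ≤ 3 * n) : v 2 * cubicNormal v n r = cubicNormal v (n + 1) (r + 2) := by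
  obtain ⟨c, rfl | rfl | rfl⟩ := exists_eq_three_mul_add r
  · rw [cubicNormal_three_mul_index, cubicNormal_three_mul_index_add_two,
      show n + 1 - (c + 1) = n - c by omega]
    ring
  · rw [cubicNormal_three_mul_index_add_one, show 3 * c + 1 + 2 = 3 * (c + 1) by omega,
      cubicNormal_three_mul_index,
      show n + 1 - (c + 1) = n - (c + 1) + 1 by omega, pow_succ, pow_succ]
    linear_combination (v 0 ^ (n - (c + 1)) * v 3 ^ c) * hv.one_two
  · rw [cubicNormal_three_mul_index_add_two, show 3 * c + 2 + 2 = 3 * (c + 1) + 1 by omega,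
      cubicNormal_three_mul_index_add_one,
      show n + 1 - (c + 1 + 1) = n - (c + 1) by omega, pow_succ]
    linear_combination (v 0 ^ (n - (c + 1)) * v 3 ^ c) * hv.two_two

theorem IsTwistedCubic.mul_cubicNormal {v : Fin 4 → R} (hv : IsTwistedCubic v) (i : Fin 4)
    {n r : ℕ} (h : r ≤ 3 * n) :
    v i * cubicNormal v n r = cubicNormal v (n + 1) (r + i) := by
  fin_cases i
  · exact cubicNormal_zero_mul v h
  · exact hv.one_mul_cubicNormal h
  · exact hv.two_mul_cubicNormal h
  · exact cubicNormal_three_mul v n r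

theorem IsTwistedCubic.pow_mul_cubicNormal {v : Fin 4 → R} (hv : IsTwistedCubic v) (i : Fin 4)
    (e : ℕ) {n r : ℕ} (h : r ≤ 3 * n) :
    v i ^ e * cubicNormal v n r = cubicNormal v (n + e) (r + e * i) := by
  induction e with
  | zero => simp
  | succ e ih =>
    have hi : (i : ℕ) ≤ 3 := by omega
    rw [pow_succ', mul_assoc, ih, hv.mul_cubicNormal i (by nlinarith)]
    congr 1
    ring

/-- Starting from 1, each factor `v i` adds 1 to the degree and `i` to the index sum. -/
theorem IsTwistedCubic.prod_pow_eq_cubicNormal {v : Fin 4 → R} (hv : IsTwistedCubic v)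
    (e : Fin 4 →₀ ℕ) :
    ∏ i, v i ^ e i = cubicNormal v (∑ i, e i) (∑ i, e i * (i : ℕ)) := by
  have h1 : (1 : R) = cubicNormal v 0 0 := by simp [cubicNormal]
  simp only [Fin.prod_univ_four, Fin.sum_univ_four]
  rw [← mul_one (_ * _), h1, mul_assoc, mul_assoc, mul_assoc,
    hv.pow_mul_cubicNormal 3 _ (by simp), hv.pow_mul_cubicNormal 2 _ (by simp; omega),
    hv.pow_mul_cubicNormal 1 _ (by simp; omega), hv.pow_mul_cubicNormal 0 _ (by simp; omega)]
  congr 1 <;> simp <;> ring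

/-- A monomial of large index sum is a multiple of some `x_{b+j} y ^ a`, and dividing it by
this factor leaves a normal monomial. -/
theorem IsTwistedCubic.exists_cubicNormal_eq_mul {v : Fin 4 → R} (hv : IsTwistedCubic v)
    {a b n r : ℕ} (hb1 : 1 ≤ b) (hb3 : b ≤ 3) (hr : 3 * a + b ≤ r) (hn : r ≤ 3 * n) :
    ∃ j ≤ 3 - b, ∃ n' r', r' ≤ 3 * n' ∧ n = n' + a + 1 ∧ r = 3 * a + b + j + r' ∧
      cubicNormal v n r = v (Fin.ofNat 4 (b + j)) * v 3 ^ a * cubicNormal v n' r' := by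
  obtain ⟨j, hj, n', r', h, rfl, rfl⟩ : ∃ j ≤ 3 - b, ∃ n' r', r' ≤ 3 * n' ∧ n = n' + a + 1 ∧
      r = 3 * a + b + j + r' :=
    -- Taking `j` as large as allowed leaves either `r' = 0` or exactly `3 * (a + 1)` removed from
    -- `r`; both give `r' ≤ 3 * n'`.
    ⟨min (r - (3 * a + b)) (3 - b), by omega, n - (a + 1),
      r - (3 * a + b) - min (r - (3 * a + b)) (3 - b), by omega, by omega, by omega⟩
  refine ⟨j, hj, n', r', h, rfl, rfl, ?_⟩
  rw [mul_assoc, hv.pow_mul_cubicNormal 3 a h, hv.mul_cubicNormal _ (by simp; omega)]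
  congr 1
  simp only [Fin.ofNat, Fin.isValue, Fin.coe_ofNat_eq_mod]
  omega

theorem IsTwistedCubic.cubicNormal_eq_zero {v : Fin 4 → R} (hv : IsTwistedCubic v)
    {a b n r : ℕ} (hb1 : 1 ≤ b) (hb3 : b ≤ 3)
    (hrel : ∀ j ≤ 3 - b, v (Fin.ofNat 4 (b + j)) * v 3 ^ a = 0)
    (hr : 3 * a + b ≤ r) (hn : r ≤ 3 * n) : cubicNormal v n r = 0 := by
  obtain ⟨j, hj, n', r', -, -, -, h⟩ := hv.exists_cubicNormal_eq_mul hb1 hb3 hr hn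
  rw [h, hrel j hj, zero_mul]

theorem IsTwistedCubic.cubicNormal_eq_reduce {v : Fin 4 → R} (hv : IsTwistedCubic v)
    {a b d n r : ℕ} (hb1 : 1 ≤ b) (hb3 : b ≤ 3)
    (hrel : ∀ j ≤ 3 - b,
      v (Fin.ofNat 4 (b + j)) * v 3 ^ a = v 0 ^ (a + d) * v (Fin.ofNat 4 j))
    (hr : 3 * a + b ≤ r) (hn : r ≤ 3 * n) :
    cubicNormal v n r = cubicNormal v (n + d) (r - (3 * a + b)) := by
  obtain ⟨j, hj, n', r', hr', rfl, rfl, h⟩ := hv.exists_cubicNormal_eq_mul hb1 hb3 hr hn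
  have hj4 : j % 4 = j := by omega
  rw [h, hrel j hj, mul_assoc, hv.mul_cubicNormal _ hr',
    hv.pow_mul_cubicNormal 0 _ (by simp; omega)]
  congr 1
  · omega
  · simp only [Fin.ofNat, Fin.isValue, Fin.coe_ofNat_eq_mod, hj4]
    omega

theorem IsTwistedCubic.cubicNormal_eq_mod {v : Fin 4 → R} (hv : IsTwistedCubic v)
    {a b d : ℕ} (hb1 : 1 ≤ b) (hb3 : b ≤ 3)
    (hrel : ∀ j ≤ 3 - b,
      v (Fin.ofNat 4 (b + j)) * v 3 ^ a = v 0 ^ (a + d) * v (Fin.ofNat 4 j))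
    (q : ℕ) {n r : ℕ} (hr : (3 * a + b) * q ≤ r) (hn : r ≤ 3 * n) :
    cubicNormal v n r = cubicNormal v (n + q * d) (r - (3 * a + b) * q) := by
  induction q with
  | zero => simp
  | succ q ih =>
    rw [mul_add, mul_one] at hr
    rw [ih (by omega), hv.cubicNormal_eq_reduce hb1 hb3 hrel (by omega) (by omega)]
    congr 1
    · ring
    · rw [mul_add, mul_one]
      omega

end CubicNormal

/-! ### Least forms -/

section LeastForm

variable {k : Type*} [Field k]

theorem leastForm_add {f g : MvPolynomial (Fin 4) k} {n p : ℕ} (hf : f.IsHomogeneous n)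
    (hf0 : f ≠ 0) (hg : g.IsHomogeneous p) (hnp : n < p) : leastForm (f + g) = f := by
  have key : ∀ i ≤ n, homogeneousComponent i (f + g) = if i = n then f else 0 := by
    intro i hi
    rw [map_add, homogeneousComponent_of_mem hf, homogeneousComponent_of_mem hg,
      if_neg (show i ≠ p by omega), add_zero]
  have hn : homogeneousComponent n (f + g) ≠ 0 := by rwa [key n le_rfl, if_pos rfl]
  have hs : sInf {i : ℕ | homogeneousComponent i (f + g) ≠ 0} = n := by
    refine le_antisymm (Nat.sInf_le hn) (le_csInf ⟨n, hn⟩ fun i hi => ?_)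
    by_contra hlt
    exact hi (by rw [key i (by omega), if_neg (by omega)])
  rw [leastForm, hs, key n le_rfl, if_pos rfl]

theorem leastForm_of_isHomogeneous {f : MvPolynomial (Fin 4) k} {n : ℕ}
    (hf : f.IsHomogeneous n) : leastForm f = f := by
  by_cases h0 : f = 0
  · simp [h0, leastForm]
  · simpa using leastForm_add hf h0 (isHomogeneous_zero (Fin 4) k (n + 1)) (Nat.lt_succ_self n)

end LeastForm

/-! ### The generators and their least forms -/

section Generators

variable (k : Type*) [Field k]

theorem isHomogeneous_x (i : ℕ) : (x k i).IsHomogeneous 1 := isHomogeneous_X _ _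

theorem leastForm_xi : leastForm (xi k) = xi k :=
  leastForm_of_isHomogeneous (n := 2)
    (((isHomogeneous_x k 1).pow 2).sub ((isHomogeneous_x k 0).mul (isHomogeneous_x k 2)))

theorem leastForm_phi (i : ℕ) : leastForm (phi k i) = phi k i :=
  leastForm_of_isHomogeneous (n := 2)
    (((isHomogeneous_x k _).mul (isHomogeneous_x k 2)).sub
      ((isHomogeneous_x k i).mul (isHomogeneous_X _ _)))

theorem leastForm_psi {a b d : ℕ} (hd : 0 < d) (j : ℕ) :
    leastForm (psi k a b d j) = x k (b + j) * y k ^ a := by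
  rw [psi, sub_eq_add_neg]
  refine leastForm_add (n := 1 + 1 * a) (p := 1 * (a + d) + 1)
    ((isHomogeneous_x k _).mul ((isHomogeneous_X _ _).pow a))
    (mul_ne_zero (X_ne_zero _) (pow_ne_zero _ (X_ne_zero _)))
    (((isHomogeneous_x k 0).pow _).mul (isHomogeneous_x k j)).neg (by omega)

/-- Lets the three values of `b` share one family, `j ≤ 3 - b`. -/
theorem theta_eq_psi {a b d : ℕ} (hb : b ≤ 3) : theta k a b d = psi k a b d (3 - b) := by
  rw [theta, psi, show b + (3 - b) = 3 by omega, pow_succ']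
  rfl

theorem leastForm_theta {a b d : ℕ} (hb : b ≤ 3) (hd : 0 < d) :
    leastForm (theta k a b d) = y k ^ (a + 1) := by
  rw [theta_eq_psi k hb, leastForm_psi k hd, show b + (3 - b) = 3 by omega, pow_succ']
  rfl

theorem mem_G_iff {a b d : ℕ} (hb1 : 1 ≤ b) (hb3 : b ≤ 3) (g : MvPolynomial (Fin 4) k) :
    g ∈ G k a b d ↔
      g = xi k ∨ g = phi k 0 ∨ g = phi k 1 ∨ ∃ j ≤ 3 - b, g = psi k a b d j := by
  have hθ := theta_eq_psi k (a := a) (d := d) hb3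
  obtain rfl | rfl | rfl : b = 1 ∨ b = 2 ∨ b = 3 := by omega
  · have h : (∃ j ≤ 3 - 1, g = psi k a 1 d j) ↔
        g = psi k a 1 d 0 ∨ g = psi k a 1 d 1 ∨ g = psi k a 1 d (3 - 1) := by
      constructor
      · rintro ⟨j, hj, rfl⟩
        interval_cases j <;> simp
      · rintro (h | h | h) <;> exact ⟨_, by omega, h⟩
    rw [h]
    simp [G, hθ]
  · have h : (∃ j ≤ 3 - 2, g = psi k a 2 d j) ↔
        g = psi k a 2 d 0 ∨ g = psi k a 2 d (3 - 2) := by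
      constructor
      · rintro ⟨j, hj, rfl⟩
        interval_cases j <;> simp
      · rintro (h | h) <;> exact ⟨_, by omega, h⟩
    rw [h]
    simp [G, hθ]
  · simp [G, hθ]

theorem mem_leastForm_image_G_iff {a b d : ℕ} (hb1 : 1 ≤ b) (hb3 : b ≤ 3) (hd : 0 < d)
    (g : MvPolynomial (Fin 4) k) :
    g ∈ leastForm '' G k a b d ↔
      g = xi k ∨ g = phi k 0 ∨ g = phi k 1 ∨ ∃ j ≤ 3 - b, g = x k (b + j) * y k ^ a := by
  constructor
  · rintro ⟨f, hf, rfl⟩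
    obtain rfl | rfl | rfl | ⟨j, hj, rfl⟩ := (mem_G_iff k hb1 hb3 f).1 hf
    · exact .inl (leastForm_xi k)
    · exact .inr (.inl (leastForm_phi k 0))
    · exact .inr (.inr (.inl (leastForm_phi k 1)))
    · exact .inr (.inr (.inr ⟨j, hj, leastForm_psi k hd j⟩))
  · intro h
    obtain rfl | rfl | rfl | ⟨j, hj, rfl⟩ := h
    · exact ⟨xi k, (mem_G_iff k hb1 hb3 _).2 (.inl rfl), leastForm_xi k⟩
    · exact ⟨phi k 0, (mem_G_iff k hb1 hb3 _).2 (.inr (.inl rfl)), leastForm_phi k 0⟩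
    · exact ⟨phi k 1, (mem_G_iff k hb1 hb3 _).2 (.inr (.inr (.inl rfl))), leastForm_phi k 1⟩
    · exact ⟨psi k a b d j, (mem_G_iff k hb1 hb3 _).2 (.inr (.inr (.inr ⟨j, hj, rfl⟩))),
        leastForm_psi k hd j⟩

theorem isTwistedCubic_mk {J : Ideal (MvPolynomial (Fin 4) k)} (h1 : xi k ∈ J)
    (h2 : phi k 0 ∈ J) (h3 : phi k 1 ∈ J) :
    IsTwistedCubic fun i : Fin 4 => Ideal.Quotient.mk J (X i) := by
  refine ⟨?_, ?_, ?_⟩ <;> simp only [← map_mul] <;> rw [Ideal.Quotient.eq]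
  · rw [← sq]
    exact h1
  · exact h2
  · exact h3

end Generators

/-! ### Normal monomials and weights -/

section Weights

/-- The pair (degree, index sum) of the normal monomial of weight `w`, if there is one. -/
noncomputable def normalPair (m₀ d w : ℕ) : ℕ × ℕ :=
  Classical.epsilon fun p => p.2 < m₀ ∧ p.1 * m₀ + p.2 * d = w

theorem eq_of_weight_eq {m₀ d n r n' r' : ℕ} (hc : m₀.Coprime d) (hr : r < m₀) (hr' : r' < m₀)
    (h : n * m₀ + r * d = n' * m₀ + r' * d) : n = n' ∧ r = r' := by
  have hmod : r * d ≡ r' * d [MOD m₀] := by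
    have := congrArg (· % m₀) h
    simpa [Nat.ModEq, Nat.add_mod] using this
  have hrr : r = r' :=
    (Nat.ModEq.cancel_right_of_coprime hc hmod).eq_of_lt_of_lt hr hr'
  subst hrr
  exact ⟨Nat.eq_of_mul_eq_mul_right (by omega) (Nat.add_right_cancel h), rfl⟩

/-- Each `m₀` taken from the index sum is repaid by `d` in the degree, preserving the weight. -/
theorem normalPair_weight {m₀ d : ℕ} (hm : 0 < m₀) (hc : m₀.Coprime d) (n r : ℕ) :
    normalPair m₀ d (n * m₀ + r * d) = (n + r / m₀ * d, r % m₀) := by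
  have hw : (n + r / m₀ * d) * m₀ + r % m₀ * d = n * m₀ + r * d := by
    conv_rhs => rw [← Nat.div_add_mod r m₀]
    ring
  have hex : ∃ p : ℕ × ℕ, p.2 < m₀ ∧ p.1 * m₀ + p.2 * d = n * m₀ + r * d :=
    ⟨(n + r / m₀ * d, r % m₀), Nat.mod_lt _ hm, hw⟩
  obtain ⟨h1, h2⟩ := Classical.epsilon_spec hex
  obtain ⟨h3, h4⟩ := eq_of_weight_eq hc h1 (Nat.mod_lt _ hm) (h2.trans hw.symm)
  exact Prod.ext h3 h4

theorem coprime_of_gcd_eq_one {m : Fin 4 → ℕ} {d : ℕ}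
    (hm : ∀ i : Fin 4, m i = m 0 + (i : ℕ) * d) (hgcd : Finset.univ.gcd m = 1) :
    (m 0).Coprime d := by
  refine Nat.dvd_one.1 (hgcd ▸ ?_)
  refine Finset.dvd_gcd fun i _ => ?_
  rw [hm i]
  exact dvd_add (Nat.gcd_dvd_left _ _) ((Nat.gcd_dvd_right _ _).mul_left _)

theorem paramHom_monomial (k : Type*) [Field k] {m : Fin 4 → ℕ} {d : ℕ}
    (hm : ∀ i : Fin 4, m i = m 0 + (i : ℕ) * d) (e : Fin 4 →₀ ℕ) :
    paramHom k m (monomial e 1) =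
      Polynomial.X ^ ((∑ i, e i) * m 0 + (∑ i, e i * (i : ℕ)) * d) := by
  rw [paramHom, aeval_monomial, map_one, one_mul, Finsupp.prod_fintype _ _ (by simp)]
  simp only [← pow_mul, Finset.prod_pow_eq_pow_sum]
  congr 1
  rw [Finset.sum_mul, Finset.sum_mul, ← Finset.sum_add_distrib]
  refine Finset.sum_congr rfl fun i _ => ?_
  rw [hm i]
  ring

end Weights

/-! ### Reduction modulo the generators and modulo their least forms -/

section Main

variable {k : Type*} [Field k]

/-- The linear map on polynomials in one variable with `t ^ w ↦ P w`. -/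
noncomputable def powLift (P : ℕ → MvPolynomial (Fin 4) k) : Polynomial k →ₗ[k] MvPolynomial (Fin 4) k :=
  (Polynomial.basisMonomials k).constr k P

theorem powLift_X_pow (P : ℕ → MvPolynomial (Fin 4) k) (w : ℕ) :
    powLift P (Polynomial.X ^ w) = P w := by
  have := (Polynomial.basisMonomials k).constr_basis k P w
  rw [Polynomial.coe_basisMonomials] at this
  rw [← Polynomial.monomial_one_right_eq_X_pow]
  exact this

theorem mk_monomial_eq_cubicNormal {J : Ideal (MvPolynomial (Fin 4) k)}
    (hv : IsTwistedCubic fun i : Fin 4 => Ideal.Quotient.mk J (X i)) (e : Fin 4 →₀ ℕ) :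
    Ideal.Quotient.mk J (monomial e 1) =
      cubicNormal (fun i : Fin 4 => Ideal.Quotient.mk J (X i))
        (∑ i, e i) (∑ i, e i * (i : ℕ)) := by
  rw [← hv.prod_pow_eq_cubicNormal, monomial_eq, map_one, one_mul,
    Finsupp.prod_fintype _ _ (by simp), map_prod]
  simp only [map_pow]

theorem index_le (e : Fin 4 →₀ ℕ) : ∑ i, e i * (i : ℕ) ≤ 3 * ∑ i, e i := by
  simp [Fin.sum_univ_four]
  omega

variable {m : Fin 4 → ℕ} {a b d : ℕ}

theorem sub_powLift_mem (hb1 : 1 ≤ b) (hb3 : b ≤ 3) (hm0 : m 0 = 3 * a + b)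
    (hm : ∀ i : Fin 4, m i = m 0 + (i : ℕ) * d) (hc : (m 0).Coprime d)
    {J : Ideal (MvPolynomial (Fin 4) k)} (h1 : xi k ∈ J) (h2 : phi k 0 ∈ J) (h3 : phi k 1 ∈ J)
    (h4 : ∀ j ≤ 3 - b, psi k a b d j ∈ J) (f : MvPolynomial (Fin 4) k) :
    f - powLift (fun w => cubicNormal X (normalPair (m 0) d w).1 (normalPair (m 0) d w).2)
      (paramHom k m f) ∈ J := by
  have hv := isTwistedCubic_mk k h1 h2 h3
  rw [← Ideal.Quotient.eq]
  induction f using MvPolynomial.induction_on' with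
  | add p q hp hq => simp only [map_add, hp, hq]
  | monomial e c =>
    have hc1 : monomial e c = c • monomial e (1 : k) := by simp [smul_monomial]
    rw [hc1, map_smul (paramHom k m), map_smul (powLift _), paramHom_monomial k hm,
      powLift_X_pow, normalPair_weight (by omega) hc, MvPolynomial.smul_eq_C_mul,
      MvPolynomial.smul_eq_C_mul, map_mul, map_mul, mk_monomial_eq_cubicNormal hv, map_cubicNormal]
    congr 1
    rw [hv.cubicNormal_eq_mod hb1 hb3 (fun j hj => ?_) ((∑ i, e i * (i : ℕ)) / m 0)
      (by rw [← hm0]; exact Nat.mul_div_le _ _) (index_le e), ← hm0]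
    · congr 1
      exact (Nat.mod_eq_sub _ _).symm
    · simp only [← map_mul, ← map_pow]
      rw [Ideal.Quotient.eq]
      exact h4 j hj

theorem homogeneousComponent_sub_powLift_mem (hd : 0 < d) (hb1 : 1 ≤ b) (hb3 : b ≤ 3)
    (hm0 : m 0 = 3 * a + b)
    (hm : ∀ i : Fin 4, m i = m 0 + (i : ℕ) * d) (hc : (m 0).Coprime d)
    {J : Ideal (MvPolynomial (Fin 4) k)} (h1 : xi k ∈ J) (h2 : phi k 0 ∈ J) (h3 : phi k 1 ∈ J)
    (h4 : ∀ j ≤ 3 - b, x k (b + j) * y k ^ a ∈ J) {f : MvPolynomial (Fin 4) k} {n : ℕ}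
    (hf : ∀ i < n, homogeneousComponent i f = 0) :
    homogeneousComponent n f -
      powLift (fun w => if (normalPair (m 0) d w).1 = n then
        cubicNormal X (normalPair (m 0) d w).1 (normalPair (m 0) d w).2 else 0)
      (paramHom k m f) ∈ J := by
  have hv := isTwistedCubic_mk k h1 h2 h3
  set L := powLift (fun w => if (normalPair (m 0) d w).1 = n then
        cubicNormal X (normalPair (m 0) d w).1 (normalPair (m 0) d w).2 else
        (0 : MvPolynomial (Fin 4) k)) with hL
  have hm0' : 0 < m 0 := by omega
  -- The bound on the degree is essential: a monomial of degree below `n` could have a normal form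
  -- of degree exactly `n`.
  have key : ∀ e : Fin 4 →₀ ℕ, n ≤ ∑ i, e i →
      homogeneousComponent n (monomial e (1 : k)) - L (paramHom k m (monomial e 1)) ∈ J := by
    intro e he
    have hhom : (monomial e (1 : k)).IsHomogeneous (∑ i, e i) :=
      isHomogeneous_monomial _ (Finsupp.degree_eq_sum e)
    rw [paramHom_monomial k hm, hL, powLift_X_pow, normalPair_weight hm0' hc,
      homogeneousComponent_of_mem hhom]
    by_cases hn : n = ∑ i, e i
    · rw [if_pos hn]
      by_cases hr : ∑ i, e i * (i : ℕ) < m 0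
      · rw [Nat.div_eq_of_lt hr, Nat.mod_eq_of_lt hr, zero_mul, add_zero, if_pos hn.symm,
          ← Ideal.Quotient.eq, mk_monomial_eq_cubicNormal hv, map_cubicNormal]
      · have : 0 < (∑ i, e i * (i : ℕ)) / m 0 * d :=
          Nat.mul_pos (Nat.div_pos (not_lt.1 hr) hm0') hd
        rw [if_neg (by simp only; omega), sub_zero, ← Ideal.Quotient.eq_zero_iff_mem,
          mk_monomial_eq_cubicNormal hv]
        refine hv.cubicNormal_eq_zero (a := a) hb1 hb3 (fun j hj => ?_) (by omega) (index_le e)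
        simp only [← map_mul, ← map_pow]
        exact Ideal.Quotient.eq_zero_iff_mem.2 (h4 j hj)
    -- Here the degree exceeds `n`, and normalizing never lowers it, so both terms vanish.
    · rw [if_neg hn, if_neg (by simp only; omega), sub_zero]
      exact J.zero_mem
  have hsum : homogeneousComponent n f - L (paramHom k m f) =
      ∑ e ∈ f.support, f.coeff e • (homogeneousComponent n (monomial e (1 : k)) -
        L (paramHom k m (monomial e 1))) := by
    have hf' : f = ∑ e ∈ f.support, f.coeff e • monomial e (1 : k) := by
      conv_lhs => rw [f.as_sum]
      simp [smul_monomial]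
    conv_lhs => rw [hf']
    simp only [map_sum, map_smul, smul_sub, Finset.sum_sub_distrib]
  rw [hsum]
  refine J.sum_mem fun e he => Submodule.smul_of_tower_mem J _ (key e ?_)
  by_contra hlt
  have := congrArg (coeff e) (hf (∑ i, e i) (not_le.1 hlt))
  rw [coeff_homogeneousComponent, if_pos (Finsupp.degree_eq_sum e), coeff_zero] at this
  exact mem_support_iff.1 he this

theorem G_subset_definingIdeal (k : Type*) [Field k] {m : Fin 4 → ℕ} {a b d : ℕ}
    (hb1 : 1 ≤ b) (hb3 : b ≤ 3) (hm0 : m 0 = 3 * a + b)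
    (hm : ∀ i : Fin 4, m i = m 0 + (i : ℕ) * d) :
    G k a b d ⊆ definingIdeal k m := by
  have h1 : m 1 = m 0 + d := by simpa using hm 1
  have h2 : m 2 = m 0 + 2 * d := by simpa using hm 2
  have h3 : m 3 = m 0 + 3 * d := by simpa using hm 3
  have hX : ∀ i, paramHom k m (X i) = Polynomial.X ^ m i := fun i => by simp [paramHom]
  intro g hg
  change paramHom k m g = 0
  obtain rfl | rfl | rfl | ⟨j, hj, rfl⟩ := (mem_G_iff k hb1 hb3 g).1 hg
  · simp only [xi, x, map_sub, map_mul, map_pow, hX, ← pow_mul, ← pow_add, sub_eq_zero]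
    congr 1
    change m 1 * 2 = m 0 + m 2
    rw [h1, h2]
    ring
  · simp only [phi, x, y, map_sub, map_mul, hX, ← pow_add, sub_eq_zero]
    congr 1
    change m 1 + m 2 = m 0 + m 3
    rw [h1, h2, h3]
    ring
  · simp only [phi, x, y, map_sub, map_mul, hX, ← pow_add, sub_eq_zero]
    congr 1
    change m 2 + m 2 = m 1 + m 3
    rw [h1, h2, h3]
    ring
  · simp only [psi, x, y, map_sub, map_mul, map_pow, hX, ← pow_mul, ← pow_add, sub_eq_zero]
    congr 1
    rw [hm (Fin.ofNat 4 (b + j)), hm (Fin.ofNat 4 j), h3]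
    simp only [Fin.ofNat, Nat.mod_eq_of_lt (show b + j < 4 by omega),
      Nat.mod_eq_of_lt (show j < 4 by omega)]
    change _ = m 0 * (a + d) + _
    rw [hm0]
    ring

end Main

end CertainMonomialCurve

theorem proposition2p4 (k : Type*) [Field k] (m : Fin 4 → ℕ) (a b d : ℕ)
    (ha : 1 ≤ a) (hb1 : 1 ≤ b) (hb3 : b ≤ 3) (hd : 0 < d)
    (hm0 : m 0 = 3 * a + b)
    (hm : ∀ i : Fin 4, m i = m 0 + (i : ℕ) * d)
    (hgcd : Finset.univ.gcd m = 1) :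
    -- the set `G` generates the defining ideal of the curve
    CertainMonomialCurve.definingIdeal k m
        = Ideal.span (CertainMonomialCurve.G k a b d) ∧
    -- the forms `g ^ *`, `g ∈ G`, generate the ideal of the tangent cone
    CertainMonomialCurve.tangentConeIdeal (CertainMonomialCurve.definingIdeal k m)
        = Ideal.span (CertainMonomialCurve.leastForm '' CertainMonomialCurve.G k a b d) ∧
    -- the set of these forms, explicitly
    (b = 1 → CertainMonomialCurve.leastForm '' CertainMonomialCurve.G k a b d =
      {(X 1 ^ 2 - X 0 * X 2 : MvPolynomial (Fin 4) k), X 1 * X 2 - X 0 * X 3,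
        X 2 ^ 2 - X 1 * X 3, X 1 * X 3 ^ a, X 2 * X 3 ^ a, X 3 ^ (a + 1)}) ∧
    (b = 2 → CertainMonomialCurve.leastForm '' CertainMonomialCurve.G k a b d =
      {(X 1 ^ 2 - X 0 * X 2 : MvPolynomial (Fin 4) k), X 1 * X 2 - X 0 * X 3,
        X 2 ^ 2 - X 1 * X 3, X 2 * X 3 ^ a, X 3 ^ (a + 1)}) ∧
    (b = 3 → CertainMonomialCurve.leastForm '' CertainMonomialCurve.G k a b d =
      {(X 1 ^ 2 - X 0 * X 2 : MvPolynomial (Fin 4) k), X 1 * X 2 - X 0 * X 3,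
        X 2 ^ 2 - X 1 * X 3, X 3 ^ (a + 1)}) := by
  have hc := CertainMonomialCurve.coprime_of_gcd_eq_one hm hgcd
  have hG := CertainMonomialCurve.G_subset_definingIdeal k hb1 hb3 hm0 hm
  have hmem := fun g => CertainMonomialCurve.mem_G_iff k (a := a) (d := d) hb1 hb3 g
  have hmem' := fun g =>
    CertainMonomialCurve.mem_leastForm_image_G_iff k (a := a) (d := d) hb1 hb3 hd g
  have hXi : CertainMonomialCurve.xi k = X 1 ^ 2 - X 0 * X 2 := rfl
  have hPhi0 : CertainMonomialCurve.phi k 0 = X 1 * X 2 - X 0 * X 3 := rfl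
  have hPhi1 : CertainMonomialCurve.phi k 1 = X 2 ^ 2 - X 1 * X 3 := by
    rw [sq]
    rfl
  refine ⟨le_antisymm (fun f hf => ?_) (Ideal.span_le.2 hG),
    le_antisymm (Ideal.span_le.2 ?_) (Ideal.span_mono (Set.image_mono hG)), ?_, ?_, ?_⟩
  · have hf0 : CertainMonomialCurve.paramHom k m f = 0 := hf
    have h := CertainMonomialCurve.sub_powLift_mem (k := k) hb1 hb3 hm0 hm hc
      (J := Ideal.span (CertainMonomialCurve.G k a b d))
      (Ideal.subset_span ((hmem _).2 (.inl rfl)))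
      (Ideal.subset_span ((hmem _).2 (.inr (.inl rfl))))
      (Ideal.subset_span ((hmem _).2 (.inr (.inr (.inl rfl)))))
      (fun j hj => Ideal.subset_span ((hmem _).2 (.inr (.inr (.inr ⟨j, hj, rfl⟩))))) f
    -- Since `f` maps to 0, its normal form is 0.
    rwa [hf0, map_zero, sub_zero] at h
  · rintro _ ⟨f, hf, rfl⟩
    have hf0 : CertainMonomialCurve.paramHom k m f = 0 := hf
    have h := CertainMonomialCurve.homogeneousComponent_sub_powLift_mem (k := k) hd hb1 hb3
      hm0 hm hc (J := Ideal.span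
        (CertainMonomialCurve.leastForm '' CertainMonomialCurve.G k a b d))
      (Ideal.subset_span ((hmem' _).2 (.inl rfl)))
      (Ideal.subset_span ((hmem' _).2 (.inr (.inl rfl))))
      (Ideal.subset_span ((hmem' _).2 (.inr (.inr (.inl rfl)))))
      (fun j hj => Ideal.subset_span ((hmem' _).2 (.inr (.inr (.inr ⟨j, hj, rfl⟩)))))
      (f := f) (n := sInf {n : ℕ | homogeneousComponent n f ≠ 0})
      (fun i hi => not_not.1 (Nat.notMem_of_lt_sInf hi))
    rwa [hf0, map_zero, sub_zero] at h
  · rintro rfl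
    simp only [CertainMonomialCurve.G, if_true, Set.image_insert_eq, Set.image_singleton,
      CertainMonomialCurve.leastForm_xi, CertainMonomialCurve.leastForm_phi,
      CertainMonomialCurve.leastForm_psi k hd, CertainMonomialCurve.leastForm_theta k hb3 hd]
    rw [hXi, hPhi0, hPhi1]
    rfl
  · rintro rfl
    simp only [CertainMonomialCurve.G, if_true, Set.image_insert_eq, Set.image_singleton,
      CertainMonomialCurve.leastForm_xi, CertainMonomialCurve.leastForm_phi,
      CertainMonomialCurve.leastForm_psi k hd, CertainMonomialCurve.leastForm_theta k hb3 hd, OfNat.ofNat_ne_one, if_false]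
    rw [hXi, hPhi0, hPhi1]
    rfl
  · rintro rfl
    simp only [CertainMonomialCurve.G, Set.image_insert_eq, Set.image_singleton,
      CertainMonomialCurve.leastForm_xi, CertainMonomialCurve.leastForm_phi,
      CertainMonomialCurve.leastForm_theta k hb3 hd, OfNat.ofNat_ne_one, if_false, Nat.reduceEqDiff]
    rw [hXi, hPhi0, hPhi1]
    rfl
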